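/- Let $n\ge 3$ be an integer and $\rho>0$. A set $\mathcal C\subset\mathbb R^2$ is called an algebraic rotor of a regular $n$-gon with apothem $\rho$ (the radius of its inscribed circle) if $$\mathcal C=\{(p(\theta)\cos\theta-p'(\theta)\sin\theta,\ p(\theta)\sin\theta+p'(\theta)\cos\theta) : \theta\in[-\pi,\pi]\}$$ for some trigonometric polynomial of the form $$p(\theta)=\rho+\sum_{k=0}^{m}\bigl(a_{kn+1}\cos((kn+1)\theta)+b_{kn+1}\sin((kn+1)\theta)+a_{kn-1}\cos((kn-1)\theta)+b_{kn-1}\sin((kn-1)\theta)\bigr)$$ with $m\ge 0$ and real coefficients, such that $p(\theta)+p''(\theta)\ge 0$ for all $\theta\in\mathbb R$. A defining polynomial of $\mathcal C$ is an irreducible $f\in\mathbb R[x,y]$ such that the polynomials in $\mathbb R[x,y]$ vanishing on $\mathcal C$ are exactly the multiples of $f$. Then every algebraic rotor of a regular $n$-gon with apothem $\rho$ that is not a circle has a defining polynomial, and the minimum, over all such non-circular rotors, of the total degree of the defining polynomial exists and equals $2n$. -/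

import Mathlib

/-- The curve `θ ∈ [-π, π] ↦ (p θ cos θ - p' θ sin θ, p θ sin θ + p' θ cos θ)`, as a set of points
of the plane. For convex curves, `p` is the support function. -/
noncomputable def supportCurve (p : ℝ → ℝ) : Set (Fin 2 → ℝ) :=
  (fun θ : ℝ => ![p θ * Real.cos θ - deriv p θ * Real.sin θ,
      p θ * Real.sin θ + deriv p θ * Real.cos θ]) '' Set.Icc (-Real.pi) Real.pi

/-- The trigonometric polynomial with constant term `ρ` and harmonics of order `k n + 1` and
`k n - 1`, for `0 ≤ k ≤ m`. The coefficients are indexed by integers, because `k n - 1 = -1`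
for `k = 0`. -/
noncomputable def rotorPolynomial (n : ℕ) (ρ : ℝ) (m : ℕ) (a b : ℤ → ℝ) (θ : ℝ) : ℝ :=
  ρ + ∑ k ∈ Finset.range (m + 1),
    (a ((k : ℤ) * n + 1) * Real.cos (((k : ℝ) * n + 1) * θ)
      + b ((k : ℤ) * n + 1) * Real.sin (((k : ℝ) * n + 1) * θ)
      + a ((k : ℤ) * n - 1) * Real.cos (((k : ℝ) * n - 1) * θ)
      + b ((k : ℤ) * n - 1) * Real.sin (((k : ℝ) * n - 1) * θ))

/-- `C` is an algebraic rotor of a regular `n`-gon with apothem `ρ`: the curve of a trigonometric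
polynomial `p` with constant term `ρ` and harmonics of order `k n ± 1`, which satisfies the
convexity condition `p + p'' ≥ 0`. -/
def IsAlgebraicRotor (n : ℕ) (ρ : ℝ) (C : Set (Fin 2 → ℝ)) : Prop :=
  ∃ (m : ℕ) (a b : ℤ → ℝ),
    (∀ θ : ℝ, 0 ≤ rotorPolynomial n ρ m a b θ + deriv (deriv (rotorPolynomial n ρ m a b)) θ) ∧
    C = supportCurve (rotorPolynomial n ρ m a b)

/-- `C` is a circle (of positive radius) of the Euclidean plane. -/
def IsPlaneCircle (C : Set (Fin 2 → ℝ)) : Prop :=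
  ∃ (c : Fin 2 → ℝ) (r : ℝ), 0 < r ∧ C = {z | (z 0 - c 0) ^ 2 + (z 1 - c 1) ^ 2 = r ^ 2}

/-- `f` is a defining polynomial of `C`: it is irreducible and the polynomials that vanish on `C`
are exactly the multiples of `f`. -/
def IsDefiningPolynomial (C : Set (Fin 2 → ℝ)) (f : MvPolynomial (Fin 2) ℝ) : Prop :=
  Irreducible f ∧ ∀ g : MvPolynomial (Fin 2) ℝ, (∀ z ∈ C, MvPolynomial.eval z g = 0) ↔ f ∣ g

/-! The support function is a Laurent polynomial `P` in `T = exp (i θ)`, of some degree `N` in both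
`T` and `T⁻¹`, and for `2 ≤ N` the coordinates of its curve are Laurent polynomials of degree
`N + 1`.

Let `x` and `y` be rational functions of `T` with a common denominator and numerators of degree at
most `d`, that of `y` being of degree `d` and prime to the denominator. Division with remainder
gives matrices `A` and `B` with `x e = A e + y B e` for `e = (1, T, …, T ^ (d - 1))`, so that
`det (x - A - y B)` is a relation of degree at most `d`. Here `d = 2 (N + 1)`, since a factor
`T ^ (N + 1)` clears the denominators. The real or the imaginary part of the relation is a nonzero
polynomial vanishing on the curve, whose vanishing ideal is therefore a nonzero prime that is not
maximal, and so principal in `ℝ[x, y]`.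

Conversely, if `P` has a nonzero constant term, the parametrization is birational. The tangent at
`T` determines `T ^ 2`, and it can be computed from any relation with nonzero gradient at the
generic point; since `x + i y = T (P - T P')` has a nonzero coefficient at `T`, it then determines
`T` as well. So `ℂ(T)` has degree `2 (N + 1)` over `ℂ(y)` and is generated by `x`, which bounds the
degree of every relation from below.

For a rotor, the orders `N ≤ 1` give circles and the orders between `2` and `n - 2` do not occur;
`ρ + (ρ / n ^ 2) cos ((n - 1) θ)` attains `N = n - 1`.
-/

section Determinant

variable {K ι : Type*} [Fintype ι]

/-- The matrix `x - M - y * N` over the polynomial ring in `x = X 0` and `y = X 1`. -/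
noncomputable def bivariatePencil [DecidableEq ι] [CommRing K] (M N : Matrix ι ι K) :
    Matrix ι ι (MvPolynomial (Fin 2) K) :=
  Matrix.scalar ι (MvPolynomial.X 0) - M.map MvPolynomial.C -
    (MvPolynomial.X 1 : MvPolynomial (Fin 2) K) • N.map MvPolynomial.C

theorem totalDegree_det_le [DecidableEq ι] [CommRing K] {σ : Type*}
    {M : Matrix ι ι (MvPolynomial σ K)} {d : ℕ} (hM : ∀ i j, (M i j).totalDegree ≤ d) :
    M.det.totalDegree ≤ Fintype.card ι * d := by
  rw [Matrix.det_apply]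
  refine MvPolynomial.totalDegree_finsetSum_le fun τ _ => ?_
  calc (Equiv.Perm.sign τ • ∏ i, M (τ i) i).totalDegree
      ≤ (∏ i, M (τ i) i).totalDegree := MvPolynomial.totalDegree_smul_le _ _
    _ ≤ ∑ i, (M (τ i) i).totalDegree := MvPolynomial.totalDegree_finsetProd _ _
    _ ≤ ∑ _i : ι, d := Finset.sum_le_sum fun i _ => hM _ _
    _ = Fintype.card ι * d := by simp

theorem totalDegree_det_bivariatePencil_le [DecidableEq ι] [CommRing K] [Nontrivial K]
    (M N : Matrix ι ι K) : (bivariatePencil M N).det.totalDegree ≤ Fintype.card ι := by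
  refine (totalDegree_det_le (d := 1) fun i j => ?_).trans (mul_one _).le
  simp only [bivariatePencil, Matrix.sub_apply, Matrix.scalar_apply, Matrix.diagonal_apply,
    Matrix.map_apply, Matrix.smul_apply, smul_eq_mul]
  refine (MvPolynomial.totalDegree_sub _ _).trans (max_le ((MvPolynomial.totalDegree_sub _ _).trans
    (max_le ?_ ?_)) ((MvPolynomial.totalDegree_mul _ _).trans ?_))
  · split_ifs <;> simp
  · simp
  · simp

theorem det_bivariatePencil_ne_zero [DecidableEq ι] [CommRing K] [Nontrivial K]
    (M N : Matrix ι ι K) : (bivariatePencil M N).det ≠ 0 := by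
  let φ : MvPolynomial (Fin 2) K →ₐ[K] Polynomial K := MvPolynomial.aeval ![Polynomial.X, 0]
  have hφ : φ.mapMatrix (bivariatePencil M N) = M.charmatrix := by
    ext i j : 1
    by_cases h : i = j <;> simp [bivariatePencil, φ, h, Polynomial.algebraMap_eq]
  intro h0
  apply (Matrix.charpoly_monic M).ne_zero
  rw [Matrix.charpoly, ← hφ, ← AlgHom.map_det, h0, map_zero]

theorem exists_aeval_eq_zero_of_mul_eq_sum {A : Type*} [CommRing K] [Nontrivial K] [CommRing A]
    [IsDomain A] [Algebra K A] {x y : A} {e : ι → A} (he : e ≠ 0) (M N : Matrix ι ι K)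
    (h : ∀ i, x * e i = ∑ j, M i j • e j + y * ∑ j, N i j • e j) :
    ∃ g : MvPolynomial (Fin 2) K, g ≠ 0 ∧ g.totalDegree ≤ Fintype.card ι ∧
      MvPolynomial.aeval ![x, y] g = 0 := by
  classical
  refine ⟨_, det_bivariatePencil_ne_zero M N, totalDegree_det_bivariatePencil_le M N, ?_⟩
  rw [AlgHom.map_det, ← Matrix.exists_mulVec_eq_zero_iff]
  refine ⟨e, he, funext fun i => ?_⟩
  have hmap : (MvPolynomial.aeval ![x, y]).mapMatrix (bivariatePencil M N) =
      Matrix.scalar ι x - M.map (algebraMap K A) - y • N.map (algebraMap K A) := by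
    ext i j
    by_cases hij : i = j <;> simp [bivariatePencil, hij]
  simp only [hmap, Matrix.sub_mulVec, Matrix.smul_mulVec, Pi.sub_apply, Pi.smul_apply,
    Matrix.scalar_apply, Matrix.mulVec_diagonal, h i]
  simp only [Matrix.mulVec, dotProduct, Matrix.map_apply, Algebra.smul_def, Algebra.algebraMap_self,
    RingHom.id_apply, Pi.zero_apply]
  ring

end Determinant

section RationalParametrization

open Polynomial IntermediateField

variable {K : Type*} [Field K]

theorem exists_degree_lt_mul_add_mul_eq {b c w : K[X]} {d : ℕ} (hbc : IsCoprime b c)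
    (hb : b.degree = d) (hc : c.degree ≤ d) (hw : w.degree < (2 * d : ℕ)) :
    ∃ u r : K[X], u.degree < d ∧ r.degree < d ∧ b * u + c * r = w := by
  obtain ⟨s, t, hst⟩ := hbc
  have hb0 : b ≠ 0 := by rintro rfl; simp at hb
  let r := t * w % b
  let u := w * s + c * (t * w / b)
  have hr_lt : r.degree < d := hb ▸ degree_mod_lt _ hb0
  have huw : b * u + c * r = w := by
    linear_combination w * hst + c * EuclideanDomain.div_add_mod (t * w) b
  refine ⟨u, r, ?_, hr_lt, huw⟩
  have hcr : (c * r).degree < (2 * d : ℕ) := by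
    rw [degree_mul, two_mul, Nat.cast_add]
    exact (add_le_add_left hc _).trans_lt (WithBot.add_lt_add_left (by simp) hr_lt)
  have hbu : (b * u).degree < (2 * d : ℕ) := by
    rw [eq_sub_of_add_eq huw]
    exact (degree_sub_le _ _).trans_lt (max_lt hw hcr)
  rw [degree_mul, hb, two_mul, Nat.cast_add] at hbu
  exact lt_of_add_lt_add_left hbu

theorem exists_aeval_div_eq_zero {a b c : K[X]} {d : ℕ} (hd : 0 < d) (hbc : IsCoprime b c)
    (hb : b.degree = d) (ha : a.degree ≤ d) (hc : c.degree ≤ d) (hc0 : c ≠ 0) :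
    ∃ g : MvPolynomial (Fin 2) K, g ≠ 0 ∧ g.totalDegree ≤ d ∧ MvPolynomial.aeval
      ![(algebraMap K[X] (RatFunc K) a / algebraMap K[X] (RatFunc K) c),
        algebraMap K[X] (RatFunc K) b / algebraMap K[X] (RatFunc K) c] g = 0 := by
  have key (i : Fin d) := exists_degree_lt_mul_add_mul_eq (w := a * X ^ (i : ℕ)) hbc hb hc (by
    rw [degree_mul, degree_X_pow, two_mul, Nat.cast_add]
    exact (add_le_add_left ha _).trans_lt
      (WithBot.add_lt_add_left (by simp) (by exact_mod_cast i.2)))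
  choose u r hu hr hur using key
  have hsum (p : K[X]) (hp : p.degree < d) : algebraMap K[X] (RatFunc K) p =
      ∑ j : Fin d, p.coeff j • (RatFunc.X : RatFunc K) ^ (j : ℕ) := by
    conv_lhs => rw [← sum_C_mul_X_pow_eq p, ← sum_fin _ (by simp) hp]
    simp [Algebra.smul_def]
  rw [← Fintype.card_fin d]
  refine exists_aeval_eq_zero_of_mul_eq_sum (e := fun i : Fin d => RatFunc.X ^ (i : ℕ))
    (fun h => ?_) (Matrix.of fun i j => (r i).coeff j) (Matrix.of fun i j => (u i).coeff j)
    fun i => ?_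
  · simpa using congrFun h ⟨0, hd⟩
  · simp only [Matrix.of_apply]
    rw [← hsum _ (hr i), ← hsum _ (hu i)]
    have hc' : algebraMap K[X] (RatFunc K) c ≠ 0 := RatFunc.algebraMap_ne_zero hc0
    field_simp
    simpa [add_comm] using congrArg (algebraMap K[X] (RatFunc K)) (hur i).symm

theorem exists_polynomial_aeval_eq_aeval {E L : Type*} [Field E] [Field L] [Algebra K E]
    [Algebra K L] [Algebra E L] [IsScalarTower K E L] {y : E} (hy : Transcendental K y)
    {g : MvPolynomial (Fin 2) K} (hg : g ≠ 0) :
    ∃ G : E[X], G ≠ 0 ∧ G.natDegree ≤ g.totalDegree ∧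
      ∀ x : L, aeval x G = MvPolynomial.aeval ![x, algebraMap E L y] g := by
  let φ : MvPolynomial (Fin 1) K →ₐ[K] E := MvPolynomial.aeval fun _ => y
  have hφ : Function.Injective φ := algebraicIndependent_unique_type_iff.2 hy
  refine ⟨(MvPolynomial.finSuccEquiv K 1 g).map φ.toRingHom, ?_, ?_, fun x => ?_⟩
  · exact (Polynomial.map_ne_zero_iff hφ).2 (by simpa using hg)
  · refine natDegree_map_le.trans ?_
    rw [MvPolynomial.natDegree_finSuccEquiv]
    exact MvPolynomial.degreeOf_le_totalDegree _ _
  · let ψ : MvPolynomial (Fin 2) K →ₐ[K] L := ((aeval x : E[X] →ₐ[E] L).restrictScalars K).comp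
      ((mapAlgHom φ).comp (MvPolynomial.finSuccEquiv K 1).toAlgHom)
    suffices ψ = MvPolynomial.aeval ![x, algebraMap E L y] from congrArg (· g) this
    refine MvPolynomial.algHom_ext fun i => ?_
    fin_cases i
    · simp [ψ, MvPolynomial.finSuccEquiv_X_zero]
    · have hX : MvPolynomial.finSuccEquiv K 1 (MvPolynomial.X 1) = C (MvPolynomial.X 0) :=
        MvPolynomial.finSuccEquiv_X_succ (j := 0)
      simp [ψ, φ, hX]

theorem finrank_adjoin_simple_le_totalDegree {L : Type*} [Field L] [Algebra K L] {x y : L}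
    (hy : Transcendental K y) (hxy : adjoin K {x, y} = ⊤)
    {g : MvPolynomial (Fin 2) K} (hg : g ≠ 0) (hg0 : MvPolynomial.aeval ![x, y] g = 0) :
    Module.finrank K⟮y⟯ L ≤ g.totalDegree := by
  have hgen : Transcendental K (AdjoinSimple.gen K y) := fun h =>
    hy (by simpa using h.algebraMap (A := L))
  obtain ⟨G, hG, hGdeg, hGeval⟩ := exists_polynomial_aeval_eq_aeval (L := L) hgen hg
  have hGx : aeval x G = 0 := by rw [hGeval, AdjoinSimple.algebraMap_gen, hg0]
  have htop : K⟮y⟯⟮x⟯ = ⊤ := by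
    rw [← restrictScalars_eq_top_iff (K := K), adjoin_simple_adjoin_simple, ← hxy, Set.pair_comm]
  calc Module.finrank K⟮y⟯ L = Module.finrank K⟮y⟯ K⟮y⟯⟮x⟯ := by rw [htop, finrank_top']
    _ = (minpoly K⟮y⟯ x).natDegree := adjoin.finrank (IsAlgebraic.isIntegral ⟨G, hG, hGx⟩)
    _ ≤ G.natDegree := natDegree_le_of_dvd (minpoly.dvd _ _ hGx) hG
    _ ≤ g.totalDegree := hGdeg

theorem max_natDegree_num_denom_div {b c : K[X]} (hbc : IsCoprime b c) (hc : c ≠ 0) :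
    max (algebraMap K[X] (RatFunc K) b / algebraMap K[X] (RatFunc K) c).num.natDegree
      (algebraMap K[X] (RatFunc K) b / algebraMap K[X] (RatFunc K) c).denom.natDegree =
      max b.natDegree c.natDegree := by
  classical
  have hgcd : gcd b c = 1 := by
    rw [← normalize_gcd, normalize_eq_one]
    exact (gcd_isUnit_iff b c).2 hbc
  have hlead : c.leadingCoeff⁻¹ ≠ 0 := inv_ne_zero (leadingCoeff_ne_zero.2 hc)
  rw [RatFunc.num_div, RatFunc.denom_div _ hc, hgcd, EuclideanDomain.div_one,
    EuclideanDomain.div_one, natDegree_C_mul hlead, natDegree_C_mul hlead]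

theorem natDegree_le_totalDegree_of_aeval_div {x : RatFunc K} {b c : K[X]} (hbc : IsCoprime b c)
    (hc0 : c ≠ 0) (hb : 0 < b.natDegree)
    (hgen : RatFunc.X ∈ adjoin K {x, algebraMap K[X] (RatFunc K) b / algebraMap K[X] (RatFunc K) c})
    {g : MvPolynomial (Fin 2) K} (hg : g ≠ 0) (hg0 : MvPolynomial.aeval
      ![x, algebraMap K[X] (RatFunc K) b / algebraMap K[X] (RatFunc K) c] g = 0) :
    b.natDegree ≤ g.totalDegree := by
  have hdeg := max_natDegree_num_denom_div hbc hc0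
  set y := algebraMap K[X] (RatFunc K) b / algebraMap K[X] (RatFunc K) c
  have hy : Transcendental K y := by
    refine RatFunc.transcendental_of_ne_C _ ?_
    rintro ⟨r, hr⟩
    simp only [hr, RatFunc.num_C, RatFunc.denom_C, natDegree_C, natDegree_one, max_self] at hdeg
    omega
  have htop : adjoin K {x, y} = ⊤ := by
    rw [eq_top_iff, ← RatFunc.adjoin_X]
    exact adjoin_simple_le_iff.2 hgen
  calc b.natDegree ≤ max b.natDegree c.natDegree := le_max_left _ _
    _ = Module.finrank K⟮y⟯ (RatFunc K) := by rw [RatFunc.finrank_eq_max_natDegree, hdeg]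
    _ ≤ g.totalDegree := finrank_adjoin_simple_le_totalDegree hy htop hg hg0

end RationalParametrization

theorem height_eq_one_of_lt {R : Type*} [CommRing R] [IsDomain R] (hdim : ringKrullDim R ≤ 2)
    {I J : Ideal R} [I.IsPrime] [J.IsPrime] (h0 : I ≠ ⊥) (hIJ : I < J) : I.height = 1 := by
  have hle : I.height + 1 ≤ 1 + 1 := by
    rw [one_add_one_eq_two]
    refine (Ideal.height_add_one_le_of_lt_of_isPrime hIJ).trans ?_
    exact WithBot.coe_le_coe.1
      ((Ideal.height_le_ringKrullDim_of_ne_top Ideal.IsPrime.ne_top').trans hdim)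
  refine le_antisymm ((ENat.add_le_add_iff_right ENat.one_ne_top).1 hle) ?_
  rw [Order.one_le_iff_ne_zero, ne_eq, Ideal.height_eq_zero_iff_eq_bot]
  exact h0

theorem exists_isDefiningPolynomial_of_isPrime {C : Set (Fin 2 → ℝ)} (hC : C.Nontrivial)
    (hprime : (MvPolynomial.vanishingIdeal ℝ C).IsPrime)
    (hbot : MvPolynomial.vanishingIdeal ℝ C ≠ ⊥) : ∃ f, IsDefiningPolynomial C f := by
  obtain ⟨z, hz, w, hw, hzw⟩ := hC
  obtain ⟨i, hi⟩ := Function.ne_iff.1 hzw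
  have hlt : MvPolynomial.vanishingIdeal ℝ C < RingHom.ker (MvPolynomial.eval z) := by
    refine SetLike.lt_iff_le_and_exists.2 ⟨fun g hg => hg z hz,
      MvPolynomial.X i - MvPolynomial.C (z i), ?_, fun h => hi ?_⟩
    · simp [RingHom.mem_ker]
    · simpa [sub_eq_zero, eq_comm] using h w hw
  have hdim : ringKrullDim (MvPolynomial (Fin 2) ℝ) ≤ 2 := by
    simp [MvPolynomial.ringKrullDim_of_isNoetherianRing]
  have := RingHom.ker_isPrime (MvPolynomial.eval z)
  obtain ⟨f, hfC, hf⟩ := hprime.exists_mem_prime_of_ne_bot hbot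
  have hspan := Ideal.eq_span_singleton_of_height_eq_one (height_eq_one_of_lt hdim hbot hlt) hfC hf
  refine ⟨f, hf.irreducible, fun g => ?_⟩
  rw [← Ideal.mem_span_singleton, ← hspan]
  rfl

section Pderiv

open MvPolynomial

variable {σ R : Type*}

theorem totalDegree_pderiv_lt [CommSemiring R] {f : MvPolynomial σ R} {i : σ}
    (h : pderiv i f ≠ 0) : (pderiv i f).totalDegree < f.totalDegree := by
  have key : ∀ m ∈ (pderiv i f).support, m.degree + 1 ≤ f.totalDegree := by
    intro m hm
    rw [mem_support_iff, coeff_pderiv] at hm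
    have hmem : m + Finsupp.single i 1 ∈ f.support :=
      mem_support_iff.2 (left_ne_zero_of_mul hm)
    have hle : (m + Finsupp.single i 1).degree ≤ f.totalDegree := le_totalDegree hmem
    simpa only [map_add, Finsupp.degree_single] using hle
  obtain ⟨m, hm⟩ := support_nonempty.2 h
  exact (Finset.sup_lt_iff (pos_of_gt (key m hm))).2 key

theorem eq_C_of_pderiv_eq_zero [CommSemiring R] [NoZeroDivisors R] [CharZero R]
    {f : MvPolynomial σ R} (h : ∀ i, pderiv i f = 0) : f = C (f.coeff 0) := by
  classical
  ext m
  rw [coeff_C]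
  split_ifs with hm
  · rw [hm]
  · obtain ⟨i, hi⟩ := Finsupp.ne_iff.1 (Ne.symm hm)
    have hcoeff := congrArg (coeff (m - Finsupp.single i 1)) (h i)
    rw [coeff_pderiv, coeff_zero, tsub_add_cancel_of_le
      (Finsupp.single_le_iff.2 (Nat.one_le_iff_ne_zero.2 hi))] at hcoeff
    exact (mul_eq_zero.1 hcoeff).resolve_right (by norm_cast)

variable {A : Type*} [CommRing A]

theorem exists_aeval_pderiv_ne_zero [CommRing R] [NoZeroDivisors R] [CharZero R] [Algebra R A]
    [FaithfulSMul R A] {x : σ → A} {f : MvPolynomial σ R} (hf : f ≠ 0) (hfx : aeval x f = 0) :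
    ∃ g : MvPolynomial σ R, aeval x g = 0 ∧ ∃ i, aeval x (pderiv i g) ≠ 0 := by
  induction hd : f.totalDegree using Nat.strong_induction_on generalizing f with
  | _ d ih =>
    subst hd
    by_contra! hcon
    by_cases hderiv : ∀ i, pderiv i f = 0
    · have hC := eq_C_of_pderiv_eq_zero hderiv
      rw [hC, aeval_C, FaithfulSMul.algebraMap_eq_zero_iff] at hfx
      exact hf (by rw [hC, hfx, C_0])
    · obtain ⟨i, hi⟩ := not_forall.1 hderiv
      obtain ⟨g, hg, j, hj⟩ := ih _ (totalDegree_pderiv_lt hi) hi (hcon f hfx i) rfl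
      exact hj (hcon g hg j)

theorem derivation_aeval [Fintype σ] [CommSemiring R] [Algebra R A] (D : Derivation R A A)
    (x : σ → A) (f : MvPolynomial σ R) :
    D (aeval x f) = ∑ i, aeval x (pderiv i f) * D (x i) := by
  classical
  induction f using MvPolynomial.induction_on with
  | C a => simp
  | add p q hp hq => simp only [map_add, hp, hq, add_mul, Finset.sum_add_distrib]
  | mul_X p j hp =>
    simp [hp, pderiv_X, Pi.single_apply, add_mul, Finset.sum_add_distrib, Finset.mul_sum,
      mul_assoc, apply_ite, ite_mul]

end Pderiv

section LaurentPolynomial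

open LaurentPolynomial

variable {R A : Type*}

theorem coeff_mul_T [Semiring R] (f : R[T;T⁻¹]) (n k : ℤ) :
    (f * T n).coeff k = f.coeff (k - n) := by
  rw [T]
  simpa using AddMonoidAlgebra.coeff_mul_single_add f (1 : R) n (k - n)

theorem coeff_C_mul_T [Semiring R] (a : R) (n k : ℤ) :
    (C a * T n).coeff k = if n = k then a else 0 := by
  rw [← single_eq_C_mul_T, AddMonoidAlgebra.coeff_single, Finsupp.single_apply]

/-- Evaluation of Laurent polynomials at a unit `x` of an algebra, as an algebra homomorphism. -/
noncomputable def laurentAeval (R : Type*) [CommSemiring R] [CommSemiring A] [Algebra R A]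
    (x : Aˣ) : R[T;T⁻¹] →ₐ[R] A :=
  { eval₂ (algebraMap R A) x with commutes' := fun r => eval₂_C _ _ r }

@[simp]
theorem laurentAeval_T [CommSemiring R] [CommSemiring A] [Algebra R A] (x : Aˣ) (n : ℤ) :
    laurentAeval R x (T n) = (x ^ n).val :=
  eval₂_T _ _ n

@[simp]
theorem laurentAeval_C [CommSemiring R] [CommSemiring A] [Algebra R A] (x : Aˣ) (r : R) :
    laurentAeval R x (C r) = algebraMap R A r :=
  eval₂_C _ _ r

theorem laurentAeval_toLaurent [CommSemiring R] [CommSemiring A] [Algebra R A] (x : Aˣ)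
    (p : Polynomial R) : laurentAeval R x p.toLaurent = Polynomial.aeval x.val p :=
  eval₂_toLaurent _ _ p

theorem laurentAeval_injective [CommRing R] [CommRing A] [Algebra R A] {x : Aˣ}
    (hx : Transcendental R x.val) : Function.Injective (laurentAeval R x) := by
  refine (injective_iff_map_eq_zero _).2 fun f hf => ?_
  obtain ⟨n, p, hp⟩ := exists_T_pow f
  have hpx : Polynomial.aeval x.val p = 0 := by
    rw [← laurentAeval_toLaurent, hp, map_mul, hf, zero_mul]
  rw [transcendental_iff.1 hx p hpx, map_zero] at hp
  exact (isUnit_T (R := R) n).mul_left_eq_zero.1 hp.symm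

theorem laurent_eq_zero_of_infinite [CommRing R] [CommRing A] [IsDomain A] [Algebra R A]
    [FaithfulSMul R A] {s : Set Aˣ} (hs : s.Infinite) {f : R[T;T⁻¹]}
    (hf : ∀ x ∈ s, laurentAeval R x f = 0) : f = 0 := by
  obtain ⟨n, p, hp⟩ := exists_T_pow f
  have hp0 : p.map (algebraMap R A) = 0 := by
    refine Polynomial.eq_zero_of_infinite_isRoot _
      ((hs.image Units.val_injective.injOn).mono (Set.image_subset_iff.2 fun x hx => ?_))
    rw [Set.mem_preimage, Set.mem_ofPred_eq, Polynomial.IsRoot, Polynomial.eval_map_algebraMap,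
      ← laurentAeval_toLaurent, hp, map_mul, hf x hx, zero_mul]
  rw [Polynomial.map_eq_zero_iff (FaithfulSMul.algebraMap_injective R A)] at hp0
  rw [hp0, map_zero] at hp
  exact (isUnit_T (R := R) n).mul_left_eq_zero.1 hp.symm

theorem exists_laurentAeval_eq_sq_add_mul_sq [CommSemiring R] [CommRing A] [Algebra R A]
    (x : Aˣ) (f : R[T;T⁻¹]) : ∃ e o : R[T;T⁻¹], (∀ m, o.coeff m = f.coeff (2 * m + 1)) ∧
      laurentAeval R x f = laurentAeval R (x ^ 2) e + x * laurentAeval R (x ^ 2) o := by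
  induction f using LaurentPolynomial.induction_on' with
  | add f g hf hg =>
    obtain ⟨e, o, ho, h⟩ := hf
    obtain ⟨e', o', ho', h'⟩ := hg
    exact ⟨e + e', o + o', fun m => by simp [ho, ho'], by simp only [map_add, h, h']; ring⟩
  | C_mul_T n a =>
    obtain ⟨m, rfl | rfl⟩ := n.even_or_odd'
    · refine ⟨C a * T m, 0, fun k => ?_, ?_⟩
      · rw [coeff_C_mul_T, if_neg (by omega)]
        rfl
      · simp [zpow_mul]
    · refine ⟨0, C a * T m, fun k => ?_, ?_⟩
      · simp only [coeff_C_mul_T, add_left_inj, mul_right_inj' (two_ne_zero (α := ℤ))]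
      · simp [zpow_mul, zpow_add, mul_comm x.val, mul_assoc]

/-- The linear map `T ^ n ↦ n T ^ n` of the Laurent polynomials. -/
noncomputable def laurentEulerLinear (R : Type*) [CommRing R] : R[T;T⁻¹] →ₗ[R] R[T;T⁻¹] where
  toFun f := .ofCoeff (Finsupp.onFinset f.coeff.support (fun k => k * f.coeff k)
    fun _ hk => Finsupp.mem_support_iff.2 (right_ne_zero_of_mul hk))
  map_add' f g := by ext k; simp [mul_add]
  map_smul' r f := by ext k; simp [mul_left_comm]

theorem laurentEulerLinear_C_mul_T [CommRing R] (a : R) (n : ℤ) :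
    laurentEulerLinear R (C a * T n) = C (n * a) * T n := by
  ext k
  change (k : R) * (C a * T n).coeff k = _
  simp only [coeff_C_mul_T]
  split_ifs with h <;> simp [h]

/-- The Euler derivation `T d/dT` of the Laurent polynomials. Under `T = exp (i θ)` it becomes
`-i d/dθ`. -/
noncomputable def laurentEuler (R : Type*) [CommRing R] : Derivation R R[T;T⁻¹] R[T;T⁻¹] :=
  Derivation.mk' (laurentEulerLinear R) fun f g => by
    induction f using LaurentPolynomial.induction_on' with
    | add f₁ f₂ h₁ h₂ => simp only [add_mul, map_add, h₁, h₂, smul_eq_mul, mul_add]; ring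
    | C_mul_T n r =>
      induction g using LaurentPolynomial.induction_on' with
      | add g₁ g₂ h₁ h₂ => simp only [mul_add, map_add, h₁, h₂, smul_eq_mul, add_mul]; ring
      | C_mul_T m s =>
        have hmul : C r * T n * (C s * T m) = C (r * s) * T (n + m) := by
          rw [T_add, map_mul]; ring
        simp only [hmul, laurentEulerLinear_C_mul_T, smul_eq_mul]
        simp only [T_add, map_mul, Int.cast_add, map_add]
        ring

@[simp]
theorem coeff_laurentEuler [CommRing R] (f : R[T;T⁻¹]) (k : ℤ) :
    (laurentEuler R f).coeff k = k * f.coeff k :=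
  rfl

theorem laurentEuler_C_mul_T [CommRing R] (a : R) (n : ℤ) :
    laurentEuler R (C a * T n) = C (n * a) * T n :=
  laurentEulerLinear_C_mul_T a n

theorem laurentEuler_T [CommRing R] (n : ℤ) : laurentEuler R (T n) = (n : R[T;T⁻¹]) * T n := by
  simpa using laurentEuler_C_mul_T (1 : R) n

end LaurentPolynomial

section LaurentToRatFunc

open LaurentPolynomial IntermediateField

variable {K : Type*} [Field K]

/-- The embedding of the Laurent polynomials into the field of rational functions. -/
noncomputable def laurentToRatFunc (K : Type*) [Field K] : K[T;T⁻¹] →ₐ[K] RatFunc K :=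
  laurentAeval K (Units.mk0 RatFunc.X RatFunc.X_ne_zero)

theorem laurentToRatFunc_injective : Function.Injective (laurentToRatFunc K) :=
  laurentAeval_injective RatFunc.transcendental_X

theorem laurentAeval_mem {L : Type*} [Field L] [Algebra K L] {F : IntermediateField K L} {x : Lˣ}
    (hx : x.val ∈ F) (f : K[T;T⁻¹]) : laurentAeval K x f ∈ F := by
  induction f using LaurentPolynomial.induction_on' with
  | add f g hf hg => rw [map_add]; exact add_mem hf hg
  | C_mul_T n a =>
    rw [map_mul, laurentAeval_C, laurentAeval_T, Units.val_zpow_eq_zpow_val]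
    exact mul_mem (F.algebraMap_mem a) (zpow_mem hx n)

theorem X_mem_of_sq_mem {F : IntermediateField K (RatFunc K)}
    (h2 : (RatFunc.X : RatFunc K) ^ 2 ∈ F) {f : K[T;T⁻¹]} (hf : laurentToRatFunc K f ∈ F) {m : ℤ}
    (hm : f.coeff (2 * m + 1) ≠ 0) : (RatFunc.X : RatFunc K) ∈ F := by
  set x : (RatFunc K)ˣ := Units.mk0 RatFunc.X RatFunc.X_ne_zero
  obtain ⟨e, o, ho, hfeo⟩ := exists_laurentAeval_eq_sq_add_mul_sq x f
  have ho0 : laurentAeval K (x ^ 2) o ≠ 0 := fun h => hm <| by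
    rw [← ho, (map_eq_zero_iff _ (laurentAeval_injective
      (RatFunc.transcendental_X.pow two_pos))).1 h]
    rfl
  have hX : RatFunc.X = (laurentToRatFunc K f - laurentAeval K (x ^ 2) e) /
      laurentAeval K (x ^ 2) o := by
    rw [laurentToRatFunc, hfeo, add_sub_cancel_left, mul_div_cancel_right₀ _ ho0]
    rfl
  rw [hX]
  exact div_mem (sub_mem hf (laurentAeval_mem h2 e)) (laurentAeval_mem h2 o)

theorem aeval_mem_adjoin {σ L : Type*} [Field L] [Algebra K L] (v : σ → L) (g : MvPolynomial σ K) :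
    MvPolynomial.aeval v g ∈ adjoin K (Set.range v) := by
  refine algebra_adjoin_le_adjoin K _ ?_
  rw [Algebra.adjoin_range_eq_range_aeval]
  exact ⟨g, rfl⟩

/-- `f` has degree exactly `N` in both `T` and `T⁻¹`. For the Laurent polynomial of a real
trigonometric polynomial, `N` is its degree. -/
structure HasTrigDegree {R : Type*} [Semiring R] (f : R[T;T⁻¹]) (N : ℕ) : Prop where
  coeff_eq_zero : ∀ k : ℤ, N < |k| → f.coeff k = 0
  coeff_ne_zero : f.coeff N ≠ 0
  coeff_neg_ne_zero : f.coeff (-N) ≠ 0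

theorem coeff_toLaurent_natCast {R : Type*} [Semiring R] (p : Polynomial R) (i : ℕ) :
    p.toLaurent.coeff i = p.coeff i :=
  Finsupp.mapDomain_apply Nat.castEmbedding.injective _ _

theorem coeff_toLaurent_of_neg {R : Type*} [Semiring R] (p : Polynomial R) {k : ℤ} (hk : k < 0) :
    p.toLaurent.coeff k = 0 :=
  Finsupp.mapDomain_of_notMem_range _ _ fun ⟨i, hi⟩ => hk.not_ge (hi ▸ Int.natCast_nonneg i)

theorem HasTrigDegree.exists_toLaurent_eq {R : Type*} [Semiring R] {f : R[T;T⁻¹]} {N : ℕ}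
    (hf : HasTrigDegree f N) : ∃ b : Polynomial R, b.degree = (2 * N : ℕ) ∧ b.coeff 0 ≠ 0 ∧
      b.toLaurent = f * T N := by
  let b : Polynomial R :=
    ∑ i ∈ Finset.range (2 * N + 1), Polynomial.monomial i (f.coeff ((i : ℤ) - N))
  have hb (i : ℕ) : b.coeff i = f.coeff ((i : ℤ) - N) := by
    simp only [b, Polynomial.finsetSum_coeff, Polynomial.coeff_monomial, Finset.sum_ite_eq',
      Finset.mem_range]
    split_ifs with hi
    · rfl
    · exact (hf.coeff_eq_zero _ (by rw [lt_abs]; omega)).symm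
  refine ⟨b, le_antisymm ?_ (Polynomial.le_degree_of_ne_zero ?_), ?_, ?_⟩
  · refine Polynomial.degree_le_iff_coeff_zero _ _ |>.2 fun i hi => ?_
    rw [hb, hf.coeff_eq_zero _ (by rw [Nat.cast_lt] at hi; rw [lt_abs]; omega)]
  · rw [hb, Nat.cast_mul, Nat.cast_two, two_mul, add_sub_cancel_right]
    exact hf.coeff_ne_zero
  · simpa [hb] using hf.coeff_neg_ne_zero
  · ext k
    rw [coeff_mul_T]
    rcases lt_or_ge k 0 with hk | hk
    · rw [coeff_toLaurent_of_neg _ hk, hf.coeff_eq_zero _ (by rw [lt_abs]; omega)]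
    · lift k to ℕ using hk
      rw [coeff_toLaurent_natCast, hb]

theorem HasTrigDegree.exists_laurentToRatFunc_eq_div {f : K[T;T⁻¹]} {N : ℕ}
    (hf : HasTrigDegree f N) : ∃ b : Polynomial K, b.degree = (2 * N : ℕ) ∧
      IsCoprime b (Polynomial.X ^ N) ∧
      laurentToRatFunc K f = algebraMap (Polynomial K) (RatFunc K) b /
        algebraMap (Polynomial K) (RatFunc K) (Polynomial.X ^ N) := by
  obtain ⟨b, hb, hb0, hbf⟩ := hf.exists_toLaurent_eq
  refine ⟨b, hb, IsCoprime.pow_right (isCoprime_comm.1 ?_), ?_⟩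
  · rwa [Polynomial.irreducible_X.coprime_iff_not_dvd, Polynomial.X_dvd_iff]
  · rw [eq_div_iff (RatFunc.algebraMap_ne_zero (pow_ne_zero _ Polynomial.X_ne_zero))]
    have h := congrArg (laurentToRatFunc K) hbf.symm
    simpa [laurentToRatFunc, laurentAeval_toLaurent] using h

end LaurentToRatFunc

section Coordinates

open LaurentPolynomial IntermediateField Complex

/-- The `x`-coordinate of the curve with support function `P`, as a Laurent polynomial in
`T = exp (i θ)`. The complex coordinates `x + i y` and `x - i y` are `T (P - T P')` and
`T⁻¹ (P + T P')`. -/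
noncomputable def laurentCoordX (P : ℂ[T;T⁻¹]) : ℂ[T;T⁻¹] :=
  (1 / 2 : ℂ) • (T 1 * (P - laurentEuler ℂ P) + T (-1) * (P + laurentEuler ℂ P))

/-- The `y`-coordinate of the curve with support function `P`, as a Laurent polynomial in
`T = exp (i θ)`. -/
noncomputable def laurentCoordY (P : ℂ[T;T⁻¹]) : ℂ[T;T⁻¹] :=
  (-I / 2) • (T 1 * (P - laurentEuler ℂ P) - T (-1) * (P + laurentEuler ℂ P))

variable {P : ℂ[T;T⁻¹]}

theorem coeff_laurentCoordX (P : ℂ[T;T⁻¹]) (k : ℤ) : (laurentCoordX P).coeff k =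
    1 / 2 * ((2 - k) * P.coeff (k - 1)) + 1 / 2 * ((2 + k) * P.coeff (k + 1)) := by
  simp only [laurentCoordX, T_mul, coeff_mul_T, coeff_laurentEuler, smul_eq_mul,
    AddMonoidAlgebra.coeff_smul, AddMonoidAlgebra.coeff_add, AddMonoidAlgebra.coeff_sub,
    Finsupp.smul_apply, Finsupp.add_apply, Finsupp.sub_apply]
  push_cast
  ring_nf

theorem coeff_laurentCoordY (P : ℂ[T;T⁻¹]) (k : ℤ) : (laurentCoordY P).coeff k =
    -I / 2 * ((2 - k) * P.coeff (k - 1)) + I / 2 * ((2 + k) * P.coeff (k + 1)) := by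
  simp only [laurentCoordY, T_mul, coeff_mul_T, coeff_laurentEuler, smul_eq_mul,
    AddMonoidAlgebra.coeff_smul, AddMonoidAlgebra.coeff_add, AddMonoidAlgebra.coeff_sub,
    Finsupp.smul_apply, Finsupp.add_apply, Finsupp.sub_apply]
  push_cast
  ring_nf

theorem HasTrigDegree.succ {R : Type*} [CommRing R] [NoZeroDivisors R] [CharZero R]
    {f g : R[T;T⁻¹]} {N : ℕ} (hf : HasTrigDegree f N) (hN : 2 ≤ N) {α β : R} (hα : α ≠ 0)
    (hβ : β ≠ 0) (hg : ∀ k : ℤ, g.coeff k =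
      α * ((2 - k) * f.coeff (k - 1)) + β * ((2 + k) * f.coeff (k + 1))) :
    HasTrigDegree g (N + 1) where
  coeff_eq_zero k hk := by
    rw [lt_abs] at hk
    rw [hg, hf.coeff_eq_zero (k - 1) (by rw [lt_abs]; omega),
      hf.coeff_eq_zero (k + 1) (by rw [lt_abs]; omega)]
    simp only [mul_zero, add_zero]
  coeff_ne_zero := by
    have hcoeff : (2 - (N + 1 : ℕ) : R) ≠ 0 := sub_ne_zero.2 (by norm_cast; omega)
    rw [hg, hf.coeff_eq_zero (_ + 1) (by rw [lt_abs]; omega), mul_zero, mul_zero, add_zero,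
      Int.cast_natCast, Nat.cast_succ (R := ℤ), add_sub_cancel_right]
    exact mul_ne_zero hα (mul_ne_zero hcoeff hf.coeff_ne_zero)
  coeff_neg_ne_zero := by
    have hcoeff : (2 + (-(N + 1 : ℕ) : ℤ) : R) ≠ 0 := by norm_cast; omega
    rw [hg, hf.coeff_eq_zero (_ - 1) (by rw [lt_abs]; omega), mul_zero, mul_zero, zero_add,
      show -((N + 1 : ℕ) : ℤ) + 1 = -N by push_cast; ring]
    exact mul_ne_zero hβ (mul_ne_zero hcoeff hf.coeff_neg_ne_zero)

theorem hasTrigDegree_laurentCoordX {N : ℕ} (hP : HasTrigDegree P N) (hN : 2 ≤ N) :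
    HasTrigDegree (laurentCoordX P) (N + 1) :=
  hP.succ hN (by norm_num) (by norm_num) (coeff_laurentCoordX P)

theorem hasTrigDegree_laurentCoordY {N : ℕ} (hP : HasTrigDegree P N) (hN : 2 ≤ N) :
    HasTrigDegree (laurentCoordY P) (N + 1) :=
  hP.succ hN (by simp [I_ne_zero]) (by simp [I_ne_zero]) (coeff_laurentCoordY P)

theorem laurentEuler_laurentCoordX (P : ℂ[T;T⁻¹]) : laurentEuler ℂ (laurentCoordX P) =
    (1 / 2 : ℂ) • ((T 1 - T (-1)) * (P - laurentEuler ℂ (laurentEuler ℂ P))) := by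
  rw [laurentCoordX, Derivation.map_smul]
  simp only [map_add, map_sub, Derivation.leibniz, laurentEuler_T, smul_eq_mul]
  push_cast
  ring_nf

theorem laurentEuler_laurentCoordY (P : ℂ[T;T⁻¹]) : laurentEuler ℂ (laurentCoordY P) =
    (-I / 2) • ((T 1 + T (-1)) * (P - laurentEuler ℂ (laurentEuler ℂ P))) := by
  rw [laurentCoordY, Derivation.map_smul]
  simp only [map_add, map_sub, Derivation.leibniz, laurentEuler_T, smul_eq_mul]
  push_cast
  ring_nf

theorem laurentCoordX_add_I_smul_laurentCoordY (P : ℂ[T;T⁻¹]) :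
    laurentCoordX P + I • laurentCoordY P = T 1 * (P - laurentEuler ℂ P) := by
  have hI : I * (-I / 2) = 1 / 2 := by linear_combination -(1 / 2) * I_sq
  rw [laurentCoordX, laurentCoordY, smul_smul, hI]
  module

-- The tangent at `T = exp (i θ)` has direction `(T⁻¹ - T : i (T + T⁻¹))`, so a relation between the
-- coordinates with nonzero gradient expresses `T ^ 2` through them.
theorem aeval_pderiv_mul_eq (hP : P.coeff 0 ≠ 0) {f : MvPolynomial (Fin 2) ℂ}
    (hf : MvPolynomial.aeval ![laurentCoordX P, laurentCoordY P] f = 0) :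
    MvPolynomial.aeval ![laurentCoordX P, laurentCoordY P] (MvPolynomial.pderiv 0 f) *
        (T 1 - T (-1)) =
      C I * MvPolynomial.aeval ![laurentCoordX P, laurentCoordY P] (MvPolynomial.pderiv 1 f) *
        (T 1 + T (-1)) := by
  have hQ : P - laurentEuler ℂ (laurentEuler ℂ P) ≠ 0 := fun h => hP <| by
    simpa using congrArg (fun Q => Q.coeff 0) h
  have h := derivation_aeval (laurentEuler ℂ) ![laurentCoordX P, laurentCoordY P] f
  rw [hf, map_zero] at h
  simp only [Fin.sum_univ_two, Matrix.cons_val_zero, Matrix.cons_val_one,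
    laurentEuler_laurentCoordX, laurentEuler_laurentCoordY, smul_eq_C_mul] at h
  set Q := P - laurentEuler ℂ (laurentEuler ℂ P)
  set u := MvPolynomial.aeval ![laurentCoordX P, laurentCoordY P] (MvPolynomial.pderiv 0 f)
  set v := MvPolynomial.aeval ![laurentCoordX P, laurentCoordY P] (MvPolynomial.pderiv 1 f)
  have hhalf : (2 * C (1 / 2) : ℂ[T;T⁻¹]) = 1 := by
    rw [← map_ofNat C, ← map_mul]; norm_num
  rw [show -I / 2 = -(I * (1 / 2)) by ring, map_neg, map_mul] at h
  refine mul_right_cancel₀ hQ ?_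
  linear_combination -2 * h - hhalf * (u * (T 1 - T (-1)) - C I * v * (T 1 + T (-1))) * Q

theorem exists_T_two_mul_aeval_eq (hP : P.coeff 0 ≠ 0) {g : MvPolynomial (Fin 2) ℂ} (hg : g ≠ 0)
    (hg0 : MvPolynomial.aeval ![laurentCoordX P, laurentCoordY P] g = 0) :
    ∃ u v : MvPolynomial (Fin 2) ℂ, MvPolynomial.aeval ![laurentCoordX P, laurentCoordY P] u ≠ 0 ∧
      T 2 * MvPolynomial.aeval ![laurentCoordX P, laurentCoordY P] u =
        MvPolynomial.aeval ![laurentCoordX P, laurentCoordY P] v := by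
  obtain ⟨f, hf, i, hi⟩ := exists_aeval_pderiv_ne_zero hg hg0
  have htangent := aeval_pderiv_mul_eq hP hf
  set e : MvPolynomial (Fin 2) ℂ →ₐ[ℂ] ℂ[T;T⁻¹] :=
    MvPolynomial.aeval ![laurentCoordX P, laurentCoordY P]
  set fx := MvPolynomial.pderiv 0 f
  set fy := MvPolynomial.pderiv 1 f
  have hslope : T 2 * e (fx - MvPolynomial.C I * fy) = e (fx + MvPolynomial.C I * fy) := by
    have hT : (T 1 * T (-1) : ℂ[T;T⁻¹]) = 1 := by rw [← T_add]; simp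
    have hTT : (T 2 : ℂ[T;T⁻¹]) = T 1 * T 1 := by rw [← T_add]; rfl
    simp only [map_sub, map_add, map_mul, MvPolynomial.algHom_C, hTT, ← C_eq_algebraMap]
    linear_combination T 1 * htangent + (e fx + C I * e fy) * hT
  refine ⟨_, _, fun hu => hi ?_, hslope⟩
  rw [hu, mul_zero, map_add, eq_comm] at hslope
  rw [map_sub] at hu
  have hx : e fx = 0 := by
    have h2 : (2 : ℂ) • e fx = 0 := by rw [two_smul]; linear_combination hu + hslope
    simpa using h2
  have hy : e fy = 0 := by simpa [hx, I_ne_zero] using hslope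
  fin_cases i
  exacts [hx, hy]

theorem algHom_aeval_pair {R A B : Type*} [CommSemiring R] [CommSemiring A] [CommSemiring B]
    [Algebra R A] [Algebra R B] (φ : A →ₐ[R] B) (x y : A) (g : MvPolynomial (Fin 2) R) :
    φ (MvPolynomial.aeval ![x, y] g) = MvPolynomial.aeval ![φ x, φ y] g := by
  rw [MvPolynomial.comp_aeval_apply, show (fun i => φ (![x, y] i)) = ![φ x, φ y] by
    ext i; fin_cases i <;> rfl]

theorem X_mem_adjoin_laurentCoord (hP : P.coeff 0 ≠ 0) {g : MvPolynomial (Fin 2) ℂ} (hg : g ≠ 0)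
    (hg0 : MvPolynomial.aeval ![laurentCoordX P, laurentCoordY P] g = 0) :
    RatFunc.X ∈ adjoin ℂ {laurentToRatFunc ℂ (laurentCoordX P),
      laurentToRatFunc ℂ (laurentCoordY P)} := by
  obtain ⟨u, v, hu, huv⟩ := exists_T_two_mul_aeval_eq hP hg hg0
  set φ := laurentToRatFunc ℂ
  set F := adjoin ℂ {φ (laurentCoordX P), φ (laurentCoordY P)}
  have hmem (f : MvPolynomial (Fin 2) ℂ) :
      φ (MvPolynomial.aeval ![laurentCoordX P, laurentCoordY P] f) ∈ F := by
    simpa [algHom_aeval_pair, F, Set.pair_comm] using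
      aeval_mem_adjoin ![φ (laurentCoordX P), φ (laurentCoordY P)] f
  have hsq : (RatFunc.X : RatFunc ℂ) ^ 2 ∈ F := by
    have hu' := (map_ne_zero_iff φ laurentToRatFunc_injective).2 hu
    have h := congrArg φ huv
    rw [map_mul, ← eq_div_iff hu'] at h
    have hX : φ (T 2) = RatFunc.X ^ 2 := by simp [φ, laurentToRatFunc]
    exact hX ▸ h ▸ div_mem (hmem v) (hmem u)
  refine X_mem_of_sq_mem hsq (f := laurentCoordX P + I • laurentCoordY P) (m := 0) ?_ ?_
  · rw [map_add, map_smul]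
    exact add_mem (subset_adjoin _ _ (by simp [φ])) (F.smul_mem (subset_adjoin _ _ (by simp [φ])))
  · simpa [laurentCoordX_add_I_smul_laurentCoordY, coeff_mul_T] using hP

theorem HasTrigDegree.exists_aeval_laurentCoord_eq_zero {N : ℕ} (hP : HasTrigDegree P N)
    (hN : 2 ≤ N) : ∃ g : MvPolynomial (Fin 2) ℂ, g ≠ 0 ∧ g.totalDegree ≤ 2 * (N + 1) ∧
      MvPolynomial.aeval ![laurentCoordX P, laurentCoordY P] g = 0 := by
  obtain ⟨a, ha, -, hx⟩ := (hasTrigDegree_laurentCoordX hP hN).exists_laurentToRatFunc_eq_div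
  obtain ⟨b, hb, hcop, hy⟩ := (hasTrigDegree_laurentCoordY hP hN).exists_laurentToRatFunc_eq_div
  obtain ⟨g, hg, hdeg, hg0⟩ := exists_aeval_div_eq_zero (by omega) hcop hb ha.le
    (by rw [Polynomial.degree_X_pow]; norm_cast; omega) (pow_ne_zero _ Polynomial.X_ne_zero)
  refine ⟨g, hg, hdeg, laurentToRatFunc_injective ?_⟩
  rw [algHom_aeval_pair, hx, hy, hg0, map_zero]

theorem HasTrigDegree.le_totalDegree {N : ℕ} (hP : HasTrigDegree P N) (hN : 2 ≤ N)
    (hP0 : P.coeff 0 ≠ 0) {g : MvPolynomial (Fin 2) ℂ} (hg : g ≠ 0)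
    (hg0 : MvPolynomial.aeval ![laurentCoordX P, laurentCoordY P] g = 0) :
    2 * (N + 1) ≤ g.totalDegree := by
  obtain ⟨b, hb, hcop, hy⟩ := (hasTrigDegree_laurentCoordY hP hN).exists_laurentToRatFunc_eq_div
  have hX := X_mem_adjoin_laurentCoord hP0 hg hg0
  have hb' := Polynomial.natDegree_eq_of_degree_eq_some hb
  rw [hy] at hX
  rw [← hb']
  refine natDegree_le_totalDegree_of_aeval_div hcop (pow_ne_zero _ Polynomial.X_ne_zero)
    (by omega) hX hg ?_
  rw [← hy, ← algHom_aeval_pair, hg0, map_zero]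

end Coordinates

section Evaluation

open LaurentPolynomial Complex

/-- Evaluation of Laurent polynomials at the point `exp (i θ)` of the unit circle. -/
noncomputable def evalAngle (θ : ℝ) : ℂ[T;T⁻¹] →ₐ[ℂ] ℂ :=
  laurentAeval ℂ (Units.mk0 (exp (θ * I)) (exp_ne_zero _))

theorem evalAngle_T (θ : ℝ) (n : ℤ) : evalAngle θ (T n) = exp (n * (θ * I)) := by
  simp [evalAngle, exp_int_mul]

theorem evalAngle_C (θ : ℝ) (a : ℂ) : evalAngle θ (C a) = a :=
  laurentAeval_C _ a

theorem laurent_eq_zero_of_forall_evalAngle {f : ℂ[T;T⁻¹]}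
    (hf : ∀ θ ∈ Set.Icc (-Real.pi) Real.pi, evalAngle θ f = 0) : f = 0 := by
  let z (θ : ℝ) : ℂˣ := Units.mk0 (exp (θ * I)) (exp_ne_zero _)
  have hz : Set.InjOn z (Set.Ioc (-Real.pi) Real.pi) := fun x hx y hy hxy => by
    simpa using exp_inj_of_neg_pi_lt_of_le_pi (x := x * I) (y := y * I) (by simpa using hx.1)
      (by simpa using hx.2) (by simpa using hy.1) (by simpa using hy.2) (congrArg Units.val hxy)
  refine laurent_eq_zero_of_infinite
    ((Set.Ioc_infinite (by linarith [Real.pi_pos])).image hz) ?_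
  rintro _ ⟨θ, hθ, rfl⟩
  exact hf θ (Set.Ioc_subset_Icc_self hθ)

theorem hasDerivAt_evalAngle (f : ℂ[T;T⁻¹]) (θ : ℝ) :
    HasDerivAt (fun t : ℝ => evalAngle t f) (I * evalAngle θ (laurentEuler ℂ f)) θ := by
  induction f using LaurentPolynomial.induction_on' with
  | add f g hf hg =>
    simp only [map_add, mul_add]
    exact hf.add hg
  | C_mul_T n a =>
    have hlin : HasDerivAt (fun t : ℝ => (n : ℂ) * ((t : ℂ) * I)) (n * (1 * I)) θ :=
      ((hasDerivAt_id θ).ofReal_comp.mul_const I).const_mul (n : ℂ)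
    simp only [laurentEuler_C_mul_T, map_mul, evalAngle_T, evalAngle_C]
    exact (hlin.cexp.const_mul a).congr_deriv (by rw [one_mul]; ring)

theorem exists_evalAngle_eq_conj (f : ℂ[T;T⁻¹]) : ∃ g : ℂ[T;T⁻¹],
    (∀ k, g.coeff (-k) = starRingEnd ℂ (f.coeff k)) ∧
      ∀ θ, evalAngle θ g = starRingEnd ℂ (evalAngle θ f) := by
  induction f using LaurentPolynomial.induction_on' with
  | add f₁ f₂ h₁ h₂ =>
    obtain ⟨g₁, hg₁, hθ₁⟩ := h₁
    obtain ⟨g₂, hg₂, hθ₂⟩ := h₂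
    exact ⟨g₁ + g₂, fun k => by simp [hg₁, hg₂], fun θ => by simp only [map_add, hθ₁, hθ₂]⟩
  | C_mul_T n a =>
    refine ⟨C (starRingEnd ℂ a) * T (-n), fun k => ?_, fun θ => ?_⟩
    · simp only [coeff_C_mul_T, neg_inj, apply_ite (starRingEnd ℂ), map_zero]
    · simp [evalAngle_C, evalAngle_T, ← exp_conj]

section Support

variable {P : ℂ[T;T⁻¹]} {p : ℝ → ℝ}

theorem I_mul_evalAngle_laurentEuler (hp : ∀ θ, evalAngle θ P = p θ) (θ : ℝ) :
    I * evalAngle θ (laurentEuler ℂ P) = deriv p θ := by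
  have h := hasDerivAt_evalAngle P θ
  simp only [hp] at h
  have hre : HasDerivAt p (I * evalAngle θ (laurentEuler ℂ P)).re θ :=
    reCLM.hasFDerivAt.comp_hasDerivAt θ h
  rw [hre.deriv]
  exact h.unique hre.ofReal_comp

theorem evalAngle_laurentCoordX (hp : ∀ θ, evalAngle θ P = p θ) (θ : ℝ) :
    evalAngle θ (laurentCoordX P) = (p θ * Real.cos θ - deriv p θ * Real.sin θ : ℝ) := by
  push_cast
  rw [← I_mul_evalAngle_laurentEuler hp, cos, sin]
  simp only [laurentCoordX, map_smul, map_add, map_sub, map_mul, evalAngle_T, hp, smul_eq_mul]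
  push_cast
  ring_nf
  simp only [I_sq]
  ring

theorem evalAngle_laurentCoordY (hp : ∀ θ, evalAngle θ P = p θ) (θ : ℝ) :
    evalAngle θ (laurentCoordY P) = (p θ * Real.sin θ + deriv p θ * Real.cos θ : ℝ) := by
  push_cast
  rw [← I_mul_evalAngle_laurentEuler hp, cos, sin]
  simp only [laurentCoordY, map_smul, map_add, map_sub, map_mul, evalAngle_T, hp, smul_eq_mul]
  push_cast
  ring_nf

theorem coeff_neg_eq_conj (hp : ∀ θ, evalAngle θ P = p θ) (k : ℤ) :
    P.coeff (-k) = starRingEnd ℂ (P.coeff k) := by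
  obtain ⟨g, hg, hθ⟩ := exists_evalAngle_eq_conj P
  have hgP : g - P = 0 := laurent_eq_zero_of_forall_evalAngle fun θ _ => by
    rw [map_sub, hθ, hp, conj_ofReal, sub_self]
  rw [← hg, sub_eq_zero.1 hgP]

theorem exists_hasTrigDegree (hp : ∀ θ, evalAngle θ P = p θ) (hP : P ≠ 0) :
    ∃ N, HasTrigDegree P N := by
  have hne : (P.coeff.support.image Int.natAbs).Nonempty := by
    simpa [Finsupp.support_nonempty_iff] using hP
  obtain ⟨k, hk, hkN⟩ := Finset.mem_image.1 (Finset.max'_mem _ hne)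
  rw [Finsupp.mem_support_iff] at hk
  have hconj : P.coeff (-k) ≠ 0 := by
    rw [coeff_neg_eq_conj hp]
    exact (map_ne_zero _).2 hk
  have hcoeff : P.coeff k.natAbs ≠ 0 ∧ P.coeff (-k.natAbs) ≠ 0 := by
    rw [← Int.abs_eq_natAbs]
    rcases abs_choice k with h | h <;> rw [h]
    · exact ⟨hk, hconj⟩
    · rw [neg_neg]
      exact ⟨hconj, hk⟩
  refine ⟨k.natAbs, fun j hj => ?_, hcoeff.1, hcoeff.2⟩
  by_contra hj0
  have hle := Finset.le_max' _ _
    (Finset.mem_image_of_mem Int.natAbs (Finsupp.mem_support_iff.2 hj0))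
  rw [← hkN] at hle
  rw [Int.abs_eq_natAbs] at hj
  omega

theorem forall_mem_supportCurve_iff (hp : ∀ θ, evalAngle θ P = p θ) {k : Type*} [CommSemiring k]
    [Algebra k ℂ] (g : MvPolynomial (Fin 2) k) :
    (∀ z ∈ supportCurve p, MvPolynomial.aeval (fun i => (z i : ℂ)) g = 0) ↔
      MvPolynomial.aeval ![laurentCoordX P, laurentCoordY P] g = 0 := by
  have heval (θ : ℝ) : evalAngle θ (MvPolynomial.aeval ![laurentCoordX P, laurentCoordY P] g) =
      MvPolynomial.aeval (fun i => ((![p θ * Real.cos θ - deriv p θ * Real.sin θ,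
        p θ * Real.sin θ + deriv p θ * Real.cos θ] i : ℝ) : ℂ)) g := by
    have h := algHom_aeval_pair ((evalAngle θ).restrictScalars k) (laurentCoordX P)
      (laurentCoordY P) g
    simp only [AlgHom.restrictScalars_apply, evalAngle_laurentCoordX hp,
      evalAngle_laurentCoordY hp] at h
    rw [h]
    congr 2
    ext i
    fin_cases i <;> rfl
  constructor
  · refine fun h => laurent_eq_zero_of_forall_evalAngle fun θ hθ => ?_
    rw [heval]
    exact h _ ⟨θ, hθ, rfl⟩
  · rintro h _ ⟨θ, -, rfl⟩
    rw [← heval, h, map_zero]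

theorem aeval_ofReal {σ : Type*} (z : σ → ℝ) (g : MvPolynomial σ ℝ) :
    MvPolynomial.aeval (fun i => (z i : ℂ)) g = (MvPolynomial.aeval z g : ℝ) :=
  MvPolynomial.aeval_algebraMap_apply ℂ z g

theorem vanishingIdeal_supportCurve (hp : ∀ θ, evalAngle θ P = p θ) :
    MvPolynomial.vanishingIdeal ℝ (supportCurve p) =
      RingHom.ker (MvPolynomial.aeval (R := ℝ) ![laurentCoordX P, laurentCoordY P]) := by
  ext g
  rw [RingHom.mem_ker, ← forall_mem_supportCurve_iff hp]
  simp only [MvPolynomial.mem_vanishingIdeal_iff, aeval_ofReal, ofReal_eq_zero]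

end Support

theorem exists_coeff_eq {σ R S : Type*} [CommSemiring R] [CommSemiring S] (φ : R →+ S)
    (g : MvPolynomial σ R) : ∃ h : MvPolynomial σ S, h.totalDegree ≤ g.totalDegree ∧
      ∀ m, h.coeff m = φ (g.coeff m) := by
  classical
  refine ⟨∑ m ∈ g.support, MvPolynomial.monomial m (φ (g.coeff m)),
    MvPolynomial.totalDegree_finsetSum_le fun m hm =>
      (MvPolynomial.totalDegree_monomial_le _ _).trans (MvPolynomial.le_totalDegree hm),
    fun m => ?_⟩
  simp only [MvPolynomial.coeff_sum, MvPolynomial.coeff_monomial, Finset.sum_ite_eq',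
    MvPolynomial.mem_support_iff]
  split_ifs with h
  · rfl
  · rw [not_not.1 h, map_zero]

theorem exists_real_polynomial_vanishing {σ : Type*} {C : Set (σ → ℝ)} {g : MvPolynomial σ ℂ}
    (hg : g ≠ 0) (h : ∀ z ∈ C, MvPolynomial.aeval (fun i => (z i : ℂ)) g = 0) :
    ∃ f ∈ MvPolynomial.vanishingIdeal ℝ C, f ≠ 0 ∧ f.totalDegree ≤ g.totalDegree := by
  obtain ⟨a, had, ha⟩ := exists_coeff_eq reAddGroupHom g
  obtain ⟨b, hbd, hb⟩ := exists_coeff_eq imAddGroupHom g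
  have hab : g = MvPolynomial.map (algebraMap ℝ ℂ) a +
      MvPolynomial.C I * MvPolynomial.map (algebraMap ℝ ℂ) b := by
    ext m
    rw [MvPolynomial.coeff_add, MvPolynomial.coeff_C_mul, MvPolynomial.coeff_map,
      MvPolynomial.coeff_map, ha, hb, mul_comm]
    exact (re_add_im _).symm
  have hvanish (z) (hz : z ∈ C) : MvPolynomial.aeval z a = 0 ∧ MvPolynomial.aeval z b = 0 := by
    have hz := h z hz
    rw [hab, map_add, map_mul, MvPolynomial.aeval_map_algebraMap, MvPolynomial.aeval_map_algebraMap,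
      MvPolynomial.algHom_C, aeval_ofReal, aeval_ofReal] at hz
    simpa [Complex.ext_iff] using hz
  by_cases ha0 : a = 0
  · refine ⟨b, fun z hz => (hvanish z hz).2, fun hb0 => hg ?_, hbd⟩
    rw [hab, ha0, hb0, map_zero, mul_zero, add_zero]
  · exact ⟨a, fun z hz => (hvanish z hz).1, ha0, had⟩

end Evaluation

section SupportCurve

open LaurentPolynomial Complex

variable {P : ℂ[T;T⁻¹]} {p : ℝ → ℝ} {N : ℕ}

theorem nontrivial_supportCurve (hp : ∀ θ, evalAngle θ P = p θ) (hP : HasTrigDegree P N)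
    (hN : 2 ≤ N) : (supportCurve p).Nontrivial := by
  obtain ⟨z, hz⟩ : (supportCurve p).Nonempty :=
    Set.Nonempty.image _ (Set.nonempty_Icc.2 (by linarith [Real.pi_pos]))
  by_contra hsub
  rw [Set.not_nontrivial_iff] at hsub
  refine (hasTrigDegree_laurentCoordX hP hN).coeff_ne_zero ?_
  have hX : laurentCoordX P - C (z 0 : ℂ) = 0 := by
    have h := (forall_mem_supportCurve_iff hp (MvPolynomial.X 0 - MvPolynomial.C (z 0 : ℂ))).1
      fun w hw => by rw [hsub hw hz]; simp
    simpa using h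
  rw [sub_eq_zero.1 hX, C_apply, if_neg (by omega)]

theorem exists_mem_vanishingIdeal_supportCurve (hp : ∀ θ, evalAngle θ P = p θ)
    (hP : HasTrigDegree P N) (hN : 2 ≤ N) :
    ∃ f ∈ MvPolynomial.vanishingIdeal ℝ (supportCurve p), f ≠ 0 ∧
      f.totalDegree ≤ 2 * (N + 1) := by
  obtain ⟨g, hg, hdeg, hg0⟩ := hP.exists_aeval_laurentCoord_eq_zero hN
  obtain ⟨f, hfC, hf, hfg⟩ :=
    exists_real_polynomial_vanishing hg ((forall_mem_supportCurve_iff hp g).2 hg0)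
  exact ⟨f, hfC, hf, hfg.trans hdeg⟩

theorem le_totalDegree_of_mem_vanishingIdeal (hp : ∀ θ, evalAngle θ P = p θ)
    (hP : HasTrigDegree P N) (hN : 2 ≤ N) (hP0 : P.coeff 0 ≠ 0) {f : MvPolynomial (Fin 2) ℝ}
    (hfC : f ∈ MvPolynomial.vanishingIdeal ℝ (supportCurve p)) (hf : f ≠ 0) :
    2 * (N + 1) ≤ f.totalDegree := by
  have hinj := MvPolynomial.map_injective (σ := Fin 2) _ (FaithfulSMul.algebraMap_injective ℝ ℂ)
  rw [vanishingIdeal_supportCurve hp, RingHom.mem_ker, ← MvPolynomial.aeval_map_algebraMap ℂ] at hfC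
  exact (hP.le_totalDegree hN hP0 ((map_ne_zero_iff _ hinj).2 hf) hfC).trans
    (Finset.sup_mono (MvPolynomial.support_map_subset _ _))

theorem exists_isDefiningPolynomial (hp : ∀ θ, evalAngle θ P = p θ) (hP : HasTrigDegree P N)
    (hN : 2 ≤ N) : ∃ f, IsDefiningPolynomial (supportCurve p) f := by
  refine exists_isDefiningPolynomial_of_isPrime (nontrivial_supportCurve hp hP hN) ?_ ?_
  · rw [vanishingIdeal_supportCurve hp]
    exact RingHom.ker_isPrime _
  · obtain ⟨f, hfC, hf, -⟩ := exists_mem_vanishingIdeal_supportCurve hp hP hN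
    exact (Submodule.ne_bot_iff _).2 ⟨f, hfC, hf⟩

theorem IsDefiningPolynomial.totalDegree_eq (hp : ∀ θ, evalAngle θ P = p θ)
    (hP : HasTrigDegree P N) (hN : 2 ≤ N) (hP0 : P.coeff 0 ≠ 0) {f : MvPolynomial (Fin 2) ℝ}
    (hf : IsDefiningPolynomial (supportCurve p) f) : f.totalDegree = 2 * (N + 1) := by
  obtain ⟨g, hgC, hg, hdeg⟩ := exists_mem_vanishingIdeal_supportCurve hp hP hN
  exact le_antisymm
    ((MvPolynomial.totalDegree_le_of_dvd_of_isDomain ((hf.2 g).1 hgC) hg).trans hdeg)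
    (le_totalDegree_of_mem_vanishingIdeal hp hP hN hP0 ((hf.2 f).2 dvd_rfl) hf.1.ne_zero)

theorem IsPlaneCircle.exists_mem_vanishingIdeal {C : Set (Fin 2 → ℝ)} (hC : IsPlaneCircle C) :
    ∃ f ∈ MvPolynomial.vanishingIdeal ℝ C, f ≠ 0 ∧ f.totalDegree ≤ 2 := by
  obtain ⟨c, r, hr, rfl⟩ := hC
  have hsq (i : Fin 2) : ((MvPolynomial.X i - MvPolynomial.C (c i)) ^ 2).totalDegree ≤ 2 := by
    refine (MvPolynomial.totalDegree_pow _ 2).trans (Nat.mul_le_mul_left 2 (m := 1) ?_)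
    exact (MvPolynomial.totalDegree_sub _ _).trans (by simp)
  refine ⟨(MvPolynomial.X 0 - MvPolynomial.C (c 0)) ^ 2 +
    (MvPolynomial.X 1 - MvPolynomial.C (c 1)) ^ 2 - MvPolynomial.C (r ^ 2), fun z hz => ?_,
    fun h => hr.ne' ?_, ?_⟩
  · simp [hz.out]
  · simpa using congrArg (MvPolynomial.eval c) h
  · refine (MvPolynomial.totalDegree_sub_C_le _ _).trans ?_
    exact (MvPolynomial.totalDegree_add _ _).trans (max_le (hsq 0) (hsq 1))

theorem not_isPlaneCircle_supportCurve (hp : ∀ θ, evalAngle θ P = p θ) (hP : HasTrigDegree P N)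
    (hN : 2 ≤ N) (hP0 : P.coeff 0 ≠ 0) : ¬IsPlaneCircle (supportCurve p) := fun hcircle => by
  obtain ⟨f, hfC, hf, hdeg⟩ := hcircle.exists_mem_vanishingIdeal
  have := le_totalDegree_of_mem_vanishingIdeal hp hP hN hP0 hfC hf
  omega

theorem isPlaneCircle_image {x y : ℝ → ℝ} {c ρ : ℂ} (hρ : ρ ≠ 0)
    (hxy : ∀ θ : ℝ, x θ + y θ * I = c + ρ * exp (θ * I)) :
    IsPlaneCircle ((fun θ => ![x θ, y θ]) '' Set.Icc (-Real.pi) Real.pi) := by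
  refine ⟨![c.re, c.im], ‖ρ‖, norm_pos_iff.2 hρ, ?_⟩
  ext z
  have hz : (z 0 - c.re) ^ 2 + (z 1 - c.im) ^ 2 = ‖ρ‖ ^ 2 ↔ ‖(z 0 + z 1 * I - c) / ρ‖ = 1 := by
    rw [norm_div, div_eq_one_iff_eq (norm_ne_zero_iff.2 hρ), ← sq_eq_sq₀ (norm_nonneg _)
      (norm_nonneg _), Complex.sq_norm (_ - c), normSq_apply]
    simp [sq]
  change _ ↔ (z 0 - c.re) ^ 2 + (z 1 - c.im) ^ 2 = ‖ρ‖ ^ 2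
  rw [hz]
  constructor
  · rintro ⟨θ, -, rfl⟩
    simp [hxy, hρ, norm_exp_ofReal_mul_I]
  · intro h
    set w := (z 0 + z 1 * I - c) / ρ with hw
    refine ⟨arg w, ⟨(neg_pi_lt_arg w).le, arg_le_pi w⟩, ?_⟩
    have hexp : exp (arg w * I) = w := by simpa [h] using norm_mul_exp_arg_mul_I w
    have hzw := hxy (arg w)
    rw [hexp, hw, mul_div_cancel₀ _ hρ, add_sub_cancel] at hzw
    simpa [Complex.ext_iff, funext_iff, Fin.forall_fin_two] using hzw

theorem laurentCoord_eq_of_coeff_eq_zero (hP : ∀ k : ℤ, 1 < |k| → P.coeff k = 0) :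
    laurentCoordX P + I • laurentCoordY P = C (2 * P.coeff (-1)) + C (P.coeff 0) * T 1 := by
  rw [laurentCoordX_add_I_smul_laurentCoordY]
  ext k
  have hcoeff : (T 1 * (P - laurentEuler ℂ P)).coeff k = (2 - k) * P.coeff (k - 1) := by
    rw [mul_comm, coeff_mul_T, AddMonoidAlgebra.coeff_sub, Finsupp.sub_apply, coeff_laurentEuler]
    push_cast
    ring
  rw [hcoeff, AddMonoidAlgebra.coeff_add, Finsupp.add_apply, C_apply, coeff_C_mul_T]
  by_cases hk : 1 < |k - 1|
  · rw [hP _ hk, if_neg (by rintro rfl; norm_num at hk), if_neg (by rintro rfl; norm_num at hk),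
      mul_zero, add_zero]
  · rw [not_lt, abs_le] at hk
    obtain rfl | rfl | rfl : k = 0 ∨ k = 1 ∨ k = 2 := by omega
    all_goals norm_num

theorem isPlaneCircle_supportCurve (hp : ∀ θ, evalAngle θ P = p θ) (hP0 : P.coeff 0 ≠ 0)
    (hP : ∀ k : ℤ, 1 < |k| → P.coeff k = 0) : IsPlaneCircle (supportCurve p) :=
  isPlaneCircle_image (c := 2 * P.coeff (-1)) hP0 fun θ => by
    have h := congrArg (evalAngle θ) (laurentCoord_eq_of_coeff_eq_zero hP)
    simpa only [map_add, map_smul, map_mul, evalAngle_laurentCoordX hp, evalAngle_laurentCoordY hp,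
      evalAngle_C, evalAngle_T, smul_eq_mul, Int.cast_one, one_mul, mul_comm I] using h

end SupportCurve

section Rotor

open LaurentPolynomial Complex

/-- The Laurent polynomial in `T = exp (i θ)` of the harmonic `α cos (j θ) + β sin (j θ)`. -/
noncomputable def laurentHarmonic (α β : ℝ) (j : ℤ) : ℂ[T;T⁻¹] :=
  C ((α - β * I) / 2) * T j + C ((α + β * I) / 2) * T (-j)

theorem evalAngle_laurentHarmonic (α β : ℝ) (j : ℤ) (θ : ℝ) :
    evalAngle θ (laurentHarmonic α β j) =
      (α * Real.cos (j * θ) + β * Real.sin (j * θ) : ℝ) := by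
  simp only [laurentHarmonic, map_add, map_mul, evalAngle_C, evalAngle_T]
  push_cast
  rw [cos, sin]
  ring_nf

theorem coeff_laurentHarmonic (α β : ℝ) (j k : ℤ) : (laurentHarmonic α β j).coeff k =
    (if j = k then (α - β * I) / 2 else 0) + (if -j = k then (α + β * I) / 2 else 0) := by
  rw [laurentHarmonic, AddMonoidAlgebra.coeff_add, Finsupp.add_apply, coeff_C_mul_T, coeff_C_mul_T]

/-- The Laurent polynomial in `T = exp (i θ)` of the support function
`rotorPolynomial n ρ m a b`. -/
noncomputable def rotorLaurent (n : ℕ) (ρ : ℝ) (m : ℕ) (a b : ℤ → ℝ) : ℂ[T;T⁻¹] :=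
  C (ρ : ℂ) + ∑ k ∈ Finset.range (m + 1),
    (laurentHarmonic (a (k * n + 1)) (b (k * n + 1)) (k * n + 1) +
      laurentHarmonic (a (k * n - 1)) (b (k * n - 1)) (k * n - 1))

section

variable {n : ℕ} {ρ : ℝ} {m : ℕ} {a b : ℤ → ℝ}

theorem evalAngle_rotorLaurent (θ : ℝ) :
    evalAngle θ (rotorLaurent n ρ m a b) = rotorPolynomial n ρ m a b θ := by
  simp only [rotorLaurent, rotorPolynomial, map_add, map_sum, evalAngle_C,
    evalAngle_laurentHarmonic]
  push_cast
  simp only [add_assoc]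

theorem coeff_rotorLaurent_of_not_dvd {k : ℤ} (hsub : ¬(n : ℤ) ∣ k - 1) (hadd : ¬(n : ℤ) ∣ k + 1) :
    (rotorLaurent n ρ m a b).coeff k = if k = 0 then (ρ : ℂ) else 0 := by
  have hzero (i : ℕ) : (laurentHarmonic (a (i * n + 1)) (b (i * n + 1)) (i * n + 1)).coeff k +
      (laurentHarmonic (a (i * n - 1)) (b (i * n - 1)) (i * n - 1)).coeff k = 0 := by
    have h₁ : (i * n + 1 : ℤ) ≠ k := fun h => hsub ⟨i, by linear_combination -h⟩
    have h₂ : -(i * n + 1 : ℤ) ≠ k := fun h => hadd ⟨-i, by linear_combination -h⟩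
    have h₃ : (i * n - 1 : ℤ) ≠ k := fun h => hadd ⟨i, by linear_combination -h⟩
    have h₄ : -(i * n - 1 : ℤ) ≠ k := fun h => hsub ⟨-i, by linear_combination -h⟩
    simp only [coeff_laurentHarmonic, h₁, h₂, h₃, h₄, if_false, add_zero]
  simp only [rotorLaurent, AddMonoidAlgebra.coeff_add, AddMonoidAlgebra.coeff_sum,
    Finsupp.add_apply, Finsupp.finsetSum_apply, hzero, Finset.sum_const_zero, add_zero, C_apply]

theorem coeff_zero_rotorLaurent (hn : n ≠ 1) : (rotorLaurent n ρ m a b).coeff 0 = ρ := by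
  have hdvd : ¬(n : ℤ) ∣ 1 := by rwa [← Nat.cast_one, Int.natCast_dvd_natCast, Nat.dvd_one]
  rw [coeff_rotorLaurent_of_not_dvd, if_pos rfl]
  · rwa [zero_sub, dvd_neg]
  · rwa [zero_add]

theorem coeff_zero_rotorLaurent_ne_zero (hn : n ≠ 1) (hρ : ρ ≠ 0) :
    (rotorLaurent n ρ m a b).coeff 0 ≠ 0 := by
  rwa [coeff_zero_rotorLaurent hn, ofReal_ne_zero]

theorem exists_hasTrigDegree_rotorLaurent (hn : n ≠ 1) (hρ : ρ ≠ 0)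
    (hC : ¬IsPlaneCircle (supportCurve (rotorPolynomial n ρ m a b))) :
    ∃ N, 2 ≤ N ∧ n ≤ N + 1 ∧ HasTrigDegree (rotorLaurent n ρ m a b) N := by
  have hP0 := coeff_zero_rotorLaurent_ne_zero (m := m) (a := a) (b := b) hn hρ
  obtain ⟨N, hN⟩ := exists_hasTrigDegree (P := rotorLaurent n ρ m a b) evalAngle_rotorLaurent
    fun h => hP0 (by rw [h]; rfl)
  have hN2 : 2 ≤ N := by
    by_contra hlt
    exact hC (isPlaneCircle_supportCurve evalAngle_rotorLaurent hP0
      fun k hk => hN.coeff_eq_zero k (by omega))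
  refine ⟨N, hN2, ?_, hN⟩
  by_contra hlt
  refine hN.coeff_ne_zero ?_
  rw [coeff_rotorLaurent_of_not_dvd, if_neg (by omega)] <;>
    exact fun h => absurd (Int.le_of_dvd (by omega) h) (by omega)

theorem exists_isDefiningPolynomial_rotor (hn : n ≠ 1) (hρ : ρ ≠ 0)
    (hC : ¬IsPlaneCircle (supportCurve (rotorPolynomial n ρ m a b))) :
    ∃ f, IsDefiningPolynomial (supportCurve (rotorPolynomial n ρ m a b)) f := by
  obtain ⟨N, hN, -, hP⟩ := exists_hasTrigDegree_rotorLaurent hn hρ hC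
  exact exists_isDefiningPolynomial evalAngle_rotorLaurent hP hN

theorem two_mul_le_totalDegree_of_rotor (hn : n ≠ 1) (hρ : ρ ≠ 0)
    (hC : ¬IsPlaneCircle (supportCurve (rotorPolynomial n ρ m a b)))
    {f : MvPolynomial (Fin 2) ℝ}
    (hf : IsDefiningPolynomial (supportCurve (rotorPolynomial n ρ m a b)) f) :
    2 * n ≤ f.totalDegree := by
  obtain ⟨N, hN, hnN, hP⟩ := exists_hasTrigDegree_rotorLaurent hn hρ hC
  rw [hf.totalDegree_eq evalAngle_rotorLaurent hP hN (coeff_zero_rotorLaurent_ne_zero hn hρ)]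
  omega

end

theorem rotorPolynomial_single {n : ℕ} (hn : 3 ≤ n) (ρ ε : ℝ) :
    rotorPolynomial n ρ 1 (Pi.single (n - 1 : ℤ) ε) 0 =
      fun θ => ρ + ε * Real.cos ((n - 1) * θ) := by
  have h₁ : (1 : ℤ) ≠ n - 1 := by omega
  have h₂ : (-1 : ℤ) ≠ n - 1 := by omega
  have h₃ : (n + 1 : ℤ) ≠ n - 1 := by omega
  ext θ
  simp [rotorPolynomial, Finset.sum_range_succ, h₁, h₂, h₃]

theorem evalAngle_C_add_laurentHarmonic (ρ ε : ℝ) (N : ℤ) (θ : ℝ) :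
    evalAngle θ (C (ρ : ℂ) + laurentHarmonic ε 0 N) = (ρ + ε * Real.cos (N * θ) : ℝ) := by
  rw [map_add, evalAngle_C, evalAngle_laurentHarmonic, zero_mul, add_zero, ofReal_add]

theorem coeff_C_add_laurentHarmonic (ρ ε : ℝ) (N k : ℤ) :
    (C (ρ : ℂ) + laurentHarmonic ε 0 N).coeff k =
      (if k = 0 then (ρ : ℂ) else 0) +
        ((if N = k then (ε : ℂ) / 2 else 0) + (if -N = k then (ε : ℂ) / 2 else 0)) := by
  simp [C_apply, coeff_laurentHarmonic]

theorem hasTrigDegree_C_add_laurentHarmonic {N : ℕ} (hN : N ≠ 0) (ρ : ℝ) {ε : ℝ} (hε : ε ≠ 0) :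
    HasTrigDegree (C (ρ : ℂ) + laurentHarmonic ε 0 N) N where
  coeff_eq_zero k hk := by
    rw [lt_abs] at hk
    rw [coeff_C_add_laurentHarmonic, if_neg (by omega), if_neg (by omega), if_neg (by omega),
      add_zero, add_zero]
  coeff_ne_zero := by
    rw [coeff_C_add_laurentHarmonic, if_neg (by omega), if_pos rfl, if_neg (by omega)]
    simpa using hε
  coeff_neg_ne_zero := by
    rw [coeff_C_add_laurentHarmonic, if_neg (by omega), if_neg (by omega), if_pos rfl]
    simpa using hε

theorem deriv_deriv_add_mul_cos (ρ ε c θ : ℝ) :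
    deriv (deriv fun t => ρ + ε * Real.cos (c * t)) θ = -(ε * c ^ 2 * Real.cos (c * θ)) := by
  have hlin (t : ℝ) : HasDerivAt (fun t => c * t) c t := by
    simpa using (hasDerivAt_id t).const_mul c
  have hderiv : deriv (fun t => ρ + ε * Real.cos (c * t)) =
      fun t => ε * (-Real.sin (c * t) * c) := by
    ext t
    exact (((hlin t).cos.const_mul ε).const_add ρ).deriv
  rw [hderiv]
  refine (((hlin θ).sin.neg.mul_const c).const_mul ε).deriv.trans ?_
  ring

theorem add_deriv_deriv_nonneg {ρ ε c : ℝ} (h : |ε * (1 - c ^ 2)| ≤ ρ) (θ : ℝ) :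
    0 ≤ ρ + ε * Real.cos (c * θ) + deriv (deriv fun t => ρ + ε * Real.cos (c * t)) θ := by
  have hle : |ε * (1 - c ^ 2) * Real.cos (c * θ)| ≤ ρ := by
    rw [abs_mul]
    exact (mul_le_of_le_one_right (abs_nonneg _) (Real.abs_cos_le_one _)).trans h
  rw [deriv_deriv_add_mul_cos]
  linarith [(abs_le.1 hle).1]

theorem isAlgebraicRotor_supportCurve_add_cos {n : ℕ} (hn : 3 ≤ n) {ρ : ℝ} (hρ : 0 < ρ) :
    IsAlgebraicRotor n ρ
      (supportCurve fun θ => ρ + ρ / n ^ 2 * Real.cos ((n - 1) * θ)) := by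
  have hn' : (3 : ℝ) ≤ n := by exact_mod_cast hn
  refine ⟨1, Pi.single (n - 1 : ℤ) (ρ / n ^ 2), 0, fun θ => ?_, by rw [rotorPolynomial_single hn]⟩
  rw [rotorPolynomial_single hn]
  refine add_deriv_deriv_nonneg ?_ θ
  have hc : |1 - ((n : ℝ) - 1) ^ 2| ≤ (n : ℝ) ^ 2 := abs_le.2 ⟨by nlinarith, by nlinarith⟩
  rw [abs_mul, abs_of_pos (by positivity)]
  calc ρ / n ^ 2 * |1 - ((n : ℝ) - 1) ^ 2| ≤ ρ / n ^ 2 * n ^ 2 := by gcongr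
    _ = ρ := by field_simp

theorem exists_rotor_totalDegree_eq {n : ℕ} (hn : 3 ≤ n) {ρ : ℝ} (hρ : 0 < ρ) :
    ∃ C f, IsAlgebraicRotor n ρ C ∧ ¬IsPlaneCircle C ∧ IsDefiningPolynomial C f ∧
      f.totalDegree = 2 * n := by
  obtain ⟨N, rfl⟩ : ∃ N, n = N + 1 := ⟨n - 1, by omega⟩
  have hN : 2 ≤ N := by omega
  have hrotor := isAlgebraicRotor_supportCurve_add_cos hn hρ
  set ε := ρ / ((N + 1 : ℕ) : ℝ) ^ 2
  have hp (θ : ℝ) := evalAngle_C_add_laurentHarmonic ρ ε N θ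
  have hP : HasTrigDegree (C (ρ : ℂ) + laurentHarmonic ε 0 N) N :=
    hasTrigDegree_C_add_laurentHarmonic (by omega) ρ (by positivity)
  have hP0 : (C (ρ : ℂ) + laurentHarmonic ε 0 N).coeff 0 ≠ 0 := by
    rw [coeff_C_add_laurentHarmonic, if_pos rfl, if_neg (by omega), if_neg (by omega), add_zero,
      add_zero]
    exact ofReal_ne_zero.2 hρ.ne'
  rw [Nat.cast_succ, add_sub_cancel_right] at hrotor
  obtain ⟨f, hf⟩ := exists_isDefiningPolynomial hp hP hN
  exact ⟨_, f, hrotor, not_isPlaneCircle_supportCurve hp hP hN hP0, hf,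
    hf.totalDegree_eq hp hP hN hP0⟩

end Rotor

theorem mainTheorem5_general (n : ℕ) (hn : 3 ≤ n) (ρ : ℝ) (hρ : 0 < ρ) :
    (∀ (m : ℕ) (a b : ℤ → ℝ), ¬IsPlaneCircle (supportCurve (rotorPolynomial n ρ m a b)) →
      (∃ f, IsDefiningPolynomial (supportCurve (rotorPolynomial n ρ m a b)) f) ∧
      ∀ f, IsDefiningPolynomial (supportCurve (rotorPolynomial n ρ m a b)) f →
        2 * n ≤ f.totalDegree) ∧
    ∃ C f, IsAlgebraicRotor n ρ C ∧ ¬IsPlaneCircle C ∧ IsDefiningPolynomial C f ∧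
      f.totalDegree = 2 * n := by
  have hn1 : n ≠ 1 := by omega
  exact ⟨fun m a b hC => ⟨exists_isDefiningPolynomial_rotor hn1 hρ.ne' hC,
    fun f hf => two_mul_le_totalDegree_of_rotor hn1 hρ.ne' hC hf⟩,
    exists_rotor_totalDegree_eq hn hρ⟩

theorem mainTheorem5 (n : ℕ) (hn : 3 ≤ n) (ρ : ℝ) (hρ : 0 < ρ) :
    (∀ C : Set (Fin 2 → ℝ), IsAlgebraicRotor n ρ C → ¬ IsPlaneCircle C →
      ∃ f : MvPolynomial (Fin 2) ℝ, IsDefiningPolynomial C f) ∧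
    IsLeast {d : ℕ | ∃ (C : Set (Fin 2 → ℝ)) (f : MvPolynomial (Fin 2) ℝ),
      IsAlgebraicRotor n ρ C ∧ ¬ IsPlaneCircle C ∧ IsDefiningPolynomial C f ∧
      f.totalDegree = d} (2 * n) := by
  obtain ⟨hcurve, hmin⟩ := mainTheorem5_general n hn ρ hρ
  refine ⟨?_, hmin, ?_⟩
  · rintro _ ⟨m, a, b, -, rfl⟩ hC
    exact (hcurve m a b hC).1
  · rintro _ ⟨_, f, ⟨m, a, b, -, rfl⟩, hC, hf, rfl⟩
    exact (hcurve m a b hC).2 f hf
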